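/- Let $n\ge 3$. A (deterministic, finite-state, complete) automaton with $n$ states is a set $\Sigma\subset\{0,1\}^{n\times n}$ of row-stochastic matrices, called letters. It is synchronizing if some finite product of letters equals $e^{T}e_i$ for some $1\le i\le n$, where $e$ is the $1\times n$ all-ones vector and $e_i$ is the $i$th standard $1\times n$ basis vector. For $t\in\mathbb N$ let $A(t)$ be the set of all columns of products of at most $t$ letters (the empty product being the identity matrix), and let the triple rendezvous time $T_{3,\Sigma}$ be the smallest $t$ such that $A(t)$ contains a vector with at least three non-zero entries; in other words, $T_{3,\Sigma}$ is the length of a shortest word that maps three distinct states to a single state. If $\Sigma$ is a synchronizing automaton with $n$ states, then $T_{3,\Sigma}$ exists and $$T_{3,\Sigma}\le \frac{n(n+4)}{4}-\frac{n \bmod 2}{4}.$$ -/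

import Mathlib

/-- A (deterministic, finite state, complete) automaton with `n` states: a set of letters, each
letter being a row-stochastic `n × n` matrix with entries in `{0, 1}`. The row `q` of a letter is
the characteristic vector of the state to which the letter sends the state `q`. -/
structure DFAutomaton (n : ℕ) where
  letters : Set (Matrix (Fin n) (Fin n) ℝ)
  binary : ∀ L ∈ letters, ∀ i j, L i j = 0 ∨ L i j = 1
  stochastic : ∀ L ∈ letters, L ∈ Matrix.rowStochastic ℝ (Fin n)

namespace DFAutomaton

variable {n : ℕ}

/-- The set of products of exactly `t` letters. -/
def wordsOfLength (S : DFAutomaton n) (t : ℕ) : Set (Matrix (Fin n) (Fin n) ℝ) :=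
  {W | ∃ w : List (Matrix (Fin n) (Fin n) ℝ), (∀ L ∈ w, L ∈ S.letters) ∧ w.length = t ∧ w.prod = W}

/-- The set of products of at most `t` letters; it contains the identity (the empty product). -/
def wordsUpTo (S : DFAutomaton n) (t : ℕ) : Set (Matrix (Fin n) (Fin n) ℝ) :=
  {W | ∃ s ≤ t, W ∈ S.wordsOfLength s}

/-- Some product of letters has all its rows equal to one standard basis vector `e_i`, that is,
it equals `eᵀ e_i` with `e` the all-ones row vector. -/
def IsSynchronizing (S : DFAutomaton n) : Prop :=
  ∃ i : Fin n, ∃ t : ℕ, Matrix.vecMulVec 1 (Pi.single i 1) ∈ S.wordsOfLength t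

/-- The vectors reachable at `t`: the columns of the products of at most `t` letters. -/
def reachable (S : DFAutomaton n) (t : ℕ) : Set (Fin n → ℝ) :=
  {v | ∃ W ∈ S.wordsUpTo t, ∃ j : Fin n, v = W.col j}

/-- The weight of a vector: the number of its non-zero entries. -/
noncomputable def weight (v : Fin n → ℝ) : ℕ :=
  {i | v i ≠ 0}.ncard

/-- The lengths `t` at which some reachable vector has weight at least `3`. -/
def tripleTimes (S : DFAutomaton n) : Set ℕ :=
  {t | ∃ v ∈ S.reachable t, 3 ≤ weight v}

/-- The triple rendezvous time `T₃`: the least element of `S.tripleTimes` (the value is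
meaningful only if this set is non-empty). -/
noncomputable def tripleRendezvousTime (S : DFAutomaton n) : ℕ :=
  sInf S.tripleTimes

end DFAutomaton

/-!
Write `A t` for the vectors reachable at `t`, a family of `0/1`-vectors, and consider the linear
program `ν t = max ∑ i, x i` over `x ≥ 0` with `x ⬝ᵥ v ≤ 1` for all `v ∈ A t`. If no vector of
`A t` has three non-zero entries, this is the fractional stable set problem of a graph, which is
half-integral: `j t = 2 (n - ν t)` is a natural number between `0` and `n`, it is never `1`, and the
face of optimal solutions has dimension `d t ≤ j t / 2`.

As `t` grows, `j t` cannot decrease, and while it is constant `d t` must drop. Indeed every letter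
maps the optimal face at `t + 1` into the one at `t`; if both spanned the same direction space,
that space would be stable under all letters, and a synchronizing word would send an optimal `x` to
a multiple of a basis vector inside the affine span of the optimal face, where some constraint
`x ⬝ᵥ v = 1` holds throughout, forcing `ν t = 1`. Therefore the pairs `(j t, d t)` with `t < T₃` are
distinct, and counting the admissible pairs bounds `T₃`.
-/

namespace FractionalPacking

open Matrix Filter Topology
open scoped Finset

section Convex

variable {𝕜 E F κ : Type*}

theorem map_mem_vectorSpan [Ring 𝕜] [AddCommGroup E] [Module 𝕜 E] [AddCommGroup F] [Module 𝕜 F]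
    {f : E →ₗ[𝕜] F} {s : Set E} {t : Set F} (h : Set.MapsTo f s t) {d : E}
    (hd : d ∈ vectorSpan 𝕜 s) : f d ∈ vectorSpan 𝕜 t :=
  vectorSpan_mono 𝕜 h.image_subset <|
    f.toAffineMap.map_vectorSpan ▸ Submodule.mem_map_of_mem hd

theorem map_eq_zero_of_mem_vectorSpan [Ring 𝕜] [AddCommGroup E] [Module 𝕜 E] [AddCommGroup F]
    [Module 𝕜 F] {f : E →ₗ[𝕜] F} {s : Set E} {c : F} (h : ∀ x ∈ s, f x = c) {d : E}
    (hd : d ∈ vectorSpan 𝕜 s) : f d = 0 := by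
  simpa using map_mem_vectorSpan (t := {c}) h hd

theorem subsingleton_setOf_lineMap_eq [Field 𝕜] {a b c : 𝕜} (h : ¬(a = c ∧ b = c)) :
    {ε : 𝕜 | AffineMap.lineMap a b ε = c}.Subsingleton := by
  have hab : ∀ ε : 𝕜, AffineMap.lineMap a b ε = c → a ≠ b := by
    rintro ε hε rfl
    rw [AffineMap.lineMap_same_apply] at hε
    exact h ⟨hε, hε⟩
  exact fun ε hε δ hδ => AffineMap.lineMap_injective 𝕜 (hab ε hε) (hε.trans hδ.symm)

variable [Field 𝕜] [LinearOrder 𝕜] [IsStrictOrderedRing 𝕜] [AddCommGroup E] [Module 𝕜 E]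

theorem exists_mem_openSegment_forall_map_eq_imp [Finite κ] (x z : E) (f : κ → E →ₗ[𝕜] 𝕜)
    (c : κ → 𝕜) : ∃ y ∈ openSegment 𝕜 x z, ∀ k, f k y = c k → f k x = c k ∧ f k z = c k := by
  have hfin : (⋃ k ∈ {k | ¬(f k x = c k ∧ f k z = c k)},
      {ε : 𝕜 | AffineMap.lineMap (f k x) (f k z) ε = c k}).Finite :=
    (Set.toFinite _).biUnion fun k hk => (subsingleton_setOf_lineMap_eq hk).finite
  obtain ⟨ε, hε, havoid⟩ := (Set.Ioo_infinite (zero_lt_one' 𝕜)).exists_notMem_finite hfin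
  refine ⟨AffineMap.lineMap x z ε, lineMap_mem_openSegment 𝕜 x z hε, fun k hk => ?_⟩
  by_contra hconst
  refine havoid (Set.mem_biUnion hconst ?_)
  rwa [← (f k).coe_toAffineMap, AffineMap.apply_lineMap] at hk

theorem exists_mem_forall_map_eq_imp_forall_mem [Finite κ] {s : Set E} (hs : Convex 𝕜 s)
    (hne : s.Nonempty) (f : κ → E →ₗ[𝕜] 𝕜) (c : κ → 𝕜) :
    ∃ x ∈ s, ∀ k, f k x = c k → ∀ z ∈ s, f k z = c k := by
  obtain ⟨x, hx, hmin⟩ :=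
    exists_minimalFor_of_wellFoundedLT (· ∈ s) (fun x => {k | f k x = c k}) hne
  refine ⟨x, hx, fun k hk z hz => ?_⟩
  obtain ⟨y, hy, hyk⟩ := exists_mem_openSegment_forall_map_eq_imp x z f c
  exact (hyk k (hmin (hs.openSegment_subset hx hz hy) (fun l hl => (hyk l hl).1) hk)).2

theorem eventually_add_mul_le {a b c : ℝ} (hac : a ≤ c) (hb : a = c → b ≤ 0) :
    ∀ᶠ ε in 𝓝[>] 0, a + ε * b ≤ c := by
  rcases hac.eq_or_lt with rfl | hlt
  · filter_upwards [self_mem_nhdsWithin] with ε hε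
    linarith [mul_nonpos_of_nonneg_of_nonpos (le_of_lt hε) (hb rfl)]
  · have hlim : Tendsto (fun ε : ℝ => a + ε * b) (𝓝[>] 0) (𝓝 (a + 0 * b)) :=
      (Continuous.tendsto (by fun_prop) 0).mono_left nhdsWithin_le_nhds
    exact hlim.eventually_le_const (by simpa using hlt)

end Convex

section VecMul

variable {ι R : Type*} [Fintype ι] [DecidableEq ι] {x : ι → R}

theorem vecMul_prod_sub_mem [CommRing R] {V : Submodule R (ι → R)} {w : List (Matrix ι ι R)}
    (hV : ∀ L ∈ w, ∀ d ∈ V, d ᵥ* L ∈ V) (hx : ∀ L ∈ w, x ᵥ* L - x ∈ V) :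
    x ᵥ* w.prod - x ∈ V := by
  induction w using List.reverseRecOn with
  | nil => simp
  | append_singleton w L ih =>
    simp only [List.mem_append, List.mem_singleton] at hV hx
    have hw : x ᵥ* w.prod - x ∈ V := ih (fun M hM => hV M (.inl hM)) fun M hM => hx M (.inl hM)
    have hsplit : x ᵥ* (w ++ [L]).prod - x = (x ᵥ* w.prod - x) ᵥ* L + (x ᵥ* L - x) := by
      rw [List.prod_append, List.prod_singleton, ← vecMul_vecMul, sub_vecMul, sub_add_sub_cancel]
    rw [hsplit]
    exact V.add_mem (hV L (.inr rfl) _ hw) (hx L (.inr rfl))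

theorem sum_vecMul_of_mem_rowStochastic [CommSemiring R] [PartialOrder R] [IsOrderedRing R]
    {M : Matrix ι ι R} (hM : M ∈ rowStochastic R ι) : ∑ i, (x ᵥ* M) i = ∑ i, x i := by
  rw [← mulVec_transpose]
  exact sum_mulVec_of_mem_colStochastic (transpose_mem_colStochastic_iff_mem_rowStochastic.2 hM)

end VecMul

section Packing

variable {ι : Type*} [Fintype ι] {A B : Set (ι → ℝ)} {x s : ι → ℝ}

/-- The fractional packings of a family `A` of vectors: the non-negative weights on the coordinates
for which every member of `A` has total weight at most `1`. -/
def packings (A : Set (ι → ℝ)) : Set (ι → ℝ) :=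
  {x | 0 ≤ x ∧ ∀ v ∈ A, x ⬝ᵥ v ≤ 1}

/-- The face of optimal solutions of the packing linear program: the fractional packings of maximal
total weight. -/
def maxPackings (A : Set (ι → ℝ)) : Set (ι → ℝ) :=
  {x ∈ packings A | IsMaxOn (fun y => ∑ i, y i) (packings A) x}

/-- The fractional packing number, the optimal value of the packing linear program. It is
meaningful only if `maxPackings A` is non-empty. -/
noncomputable def packingNumber (A : Set (ι → ℝ)) : ℝ :=
  sSup ((fun x => ∑ i, x i) '' packings A)

/-- The dimension of the face of optimal solutions of the packing linear program. -/
noncomputable def faceDim (A : Set (ι → ℝ)) : ℕ :=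
  Module.finrank ℝ (vectorSpan ℝ (maxPackings A))

theorem packings_eq_inter (A : Set (ι → ℝ)) :
    packings A = Set.Ici 0 ∩ ⋂ v ∈ A, {x | x ⬝ᵥ v ≤ 1} := by
  ext x
  simp [packings]

theorem packings_anti (h : A ⊆ B) : packings B ⊆ packings A :=
  fun _ hx => ⟨hx.1, fun v hv => hx.2 v (h hv)⟩

theorem convex_packings (A : Set (ι → ℝ)) : Convex ℝ (packings A) := by
  rw [packings_eq_inter]
  exact (convex_Ici 0).inter <| convex_iInter₂ fun v _ =>
    convex_halfSpace_le ((dotProductBilin ℝ ℝ).flip v).isLinear 1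

theorem isClosed_packings (A : Set (ι → ℝ)) : IsClosed (packings A) := by
  rw [packings_eq_inter]
  exact isClosed_Ici.inter <| isClosed_biInter fun v _ =>
    isClosed_le (continuous_id.dotProduct continuous_const) continuous_const

theorem sum_eq_packingNumber (hx : x ∈ maxPackings A) : ∑ i, x i = packingNumber A :=
  have hgreatest : IsGreatest ((fun y => ∑ i, y i) '' packings A) (∑ i, x i) :=
    ⟨Set.mem_image_of_mem _ hx.1, Set.forall_mem_image.2 fun _ hz => hx.2 hz⟩
  hgreatest.csSup_eq.symm

theorem sum_le_packingNumber (hA : (maxPackings A).Nonempty) (hx : x ∈ packings A) :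
    ∑ i, x i ≤ packingNumber A := by
  obtain ⟨y, hy⟩ := hA
  exact sum_eq_packingNumber hy ▸ hy.2 hx

theorem mem_maxPackings_of_sum_eq (hA : (maxPackings A).Nonempty) (hx : x ∈ packings A)
    (h : ∑ i, x i = packingNumber A) : x ∈ maxPackings A :=
  ⟨hx, fun _ hz => (sum_le_packingNumber hA hz).trans_eq h.symm⟩

theorem packingNumber_anti (hA : (maxPackings A).Nonempty) (hB : (maxPackings B).Nonempty)
    (h : A ⊆ B) : packingNumber B ≤ packingNumber A := by
  obtain ⟨x, hx⟩ := hB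
  exact sum_eq_packingNumber hx ▸ sum_le_packingNumber hA (packings_anti h hx.1)

theorem convex_maxPackings (A : Set (ι → ℝ)) : Convex ℝ (maxPackings A) := by
  intro x hx y hy a b ha hb hab
  refine mem_maxPackings_of_sum_eq ⟨x, hx⟩ (convex_packings A hx.1 hy.1 ha hb hab) ?_
  simp only [Pi.add_apply, Pi.smul_apply, smul_eq_mul, Finset.sum_add_distrib, ← Finset.mul_sum,
    sum_eq_packingNumber hx, sum_eq_packingNumber hy, ← add_mul, hab, one_mul]

/-- Otherwise `x + ε • s` would be a better packing for small `ε > 0`. -/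
theorem sum_nonpos_of_active (hA : A.Finite) (hx : x ∈ maxPackings A)
    (hzero : ∀ i, x i = 0 → 0 ≤ s i) (htight : ∀ v ∈ A, x ⬝ᵥ v = 1 → s ⬝ᵥ v ≤ 0) :
    ∑ i, s i ≤ 0 := by
  have hnonneg : ∀ᶠ ε : ℝ in 𝓝[>] 0, ∀ i, -x i + ε * -s i ≤ 0 := eventually_all.2 fun i =>
    eventually_add_mul_le (neg_nonpos.2 (hx.1.1 i)) fun h =>
      neg_nonpos.2 (hzero i (neg_eq_zero.1 h))
  have hle : ∀ᶠ ε : ℝ in 𝓝[>] 0, ∀ v ∈ A, x ⬝ᵥ v + ε * (s ⬝ᵥ v) ≤ 1 :=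
    (eventually_all_finite hA).2 fun v hv => eventually_add_mul_le (hx.1.2 v hv) (htight v hv)
  obtain ⟨ε, ⟨hεnonneg, hεle⟩, hε⟩ := ((hnonneg.and hle).and self_mem_nhdsWithin).exists
  have hmem : x + ε • s ∈ packings A :=
    ⟨fun i => by simpa [neg_le_iff_add_nonneg'] using hεnonneg i,
      fun v hv => by simpa [add_dotProduct, smul_dotProduct] using hεle v hv⟩
  have hsum : ∑ i, x i + ε * ∑ i, s i ≤ ∑ i, x i := by
    simpa [Finset.sum_add_distrib, Finset.mul_sum] using hx.2 hmem
  exact nonpos_of_mul_nonpos_right (by linarith) hε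

theorem sum_eq_zero_of_active (hA : A.Finite) (hx : x ∈ maxPackings A)
    (hzero : ∀ i, x i = 0 → s i = 0) (htight : ∀ v ∈ A, x ⬝ᵥ v = 1 → s ⬝ᵥ v = 0) :
    ∑ i, s i = 0 := by
  refine le_antisymm (sum_nonpos_of_active hA hx (fun i hi => (hzero i hi).ge)
    fun v hv h => (htight v hv h).le) (neg_nonpos.1 ?_)
  rw [← Finset.sum_neg_distrib]
  exact sum_nonpos_of_active (s := -s) hA hx (fun i hi => by simp [hzero i hi])
    fun v hv h => by simp [htight v hv h]

theorem exists_tight_pos (hA : A.Finite) (hx : x ∈ maxPackings A) (i : ι) :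
    ∃ v ∈ A, 0 < v i ∧ x ⬝ᵥ v = 1 := by
  classical
  by_contra! h
  have hsum := sum_nonpos_of_active (s := Pi.single i 1) hA hx
    (fun j _ => (Pi.single_nonneg.2 zero_le_one : (0 : ι → ℝ) ≤ Pi.single i 1) j)
    (fun v hv hxv => by simpa using not_lt.1 fun hi => h v hv hi hxv)
  simp only [Finset.sum_pi_single', Finset.mem_univ, if_true] at hsum
  exact absurd hsum (by norm_num)

/-- Besides the constraints, the equations `z i = 1 / 2` are made generic because the half-integral
rounding of `x` depends on which of them hold. -/
theorem exists_generic_maxPacking (hA : A.Finite) (hne : (maxPackings A).Nonempty) :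
    ∃ x ∈ maxPackings A, (∀ v ∈ A, x ⬝ᵥ v = 1 → ∀ z ∈ maxPackings A, z ⬝ᵥ v = 1) ∧
      ∀ i, x i = 1 / 2 → ∀ z ∈ maxPackings A, z i = 1 / 2 := by
  have := hA.to_subtype
  obtain ⟨x, hx, hgen⟩ := exists_mem_forall_map_eq_imp_forall_mem (convex_maxPackings A) hne
    (Sum.elim (fun v : A => (dotProductBilin ℝ ℝ).flip v.1) LinearMap.proj)
    (Sum.elim (fun _ => 1) fun _ => 1 / 2)
  exact ⟨x, hx, fun v hv => hgen (.inl ⟨v, hv⟩), fun i => hgen (.inr i)⟩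

theorem exists_mem_forall_maxPackings_tight [Nonempty ι] (hA : A.Finite)
    (hne : (maxPackings A).Nonempty) : ∃ v ∈ A, ∀ z ∈ maxPackings A, z ⬝ᵥ v = 1 := by
  obtain ⟨x, hx, htight, -⟩ := exists_generic_maxPacking hA hne
  obtain ⟨v, hv, -, hxv⟩ := exists_tight_pos hA hx (Classical.arbitrary ι)
  exact ⟨v, hv, htight v hv hxv⟩

variable [DecidableEq ι]

theorem le_one_of_mem_packings (hA : ∀ i, Pi.single i 1 ∈ A) (hx : x ∈ packings A) : x ≤ 1 :=
  fun i => by simpa using hx.2 _ (hA i)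

theorem maxPackings_nonempty (hA : ∀ i, Pi.single i 1 ∈ A) : (maxPackings A).Nonempty := by
  have hcompact : IsCompact (packings A) := isCompact_Icc.of_isClosed_subset
    (isClosed_packings A) fun x hx => ⟨hx.1, le_one_of_mem_packings hA hx⟩
  obtain ⟨x, hx, hmax⟩ := hcompact.exists_isMaxOn ⟨0, le_rfl, by simp⟩
    (f := fun x : ι → ℝ => ∑ i, x i) (by fun_prop)
  exact ⟨x, hx, hmax⟩

end Packing

section Graphic

variable {ι : Type*} [DecidableEq ι] {A : Set (ι → ℝ)} {x : ι → ℝ}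

/-- A family consisting of the indicator vectors of all vertices and of the edges of a graph on
`ι`, possibly together with `0`. Its fractional packings are the fractional stable sets of that
graph. -/
structure IsGraphic (A : Set (ι → ℝ)) : Prop where
  single_mem : ∀ i, Pi.single i 1 ∈ A
  eq_zero_or_vertex_or_edge : ∀ v ∈ A, v = 0 ∨ (∃ i, v = Pi.single i 1) ∨
    ∃ i j, i ≠ j ∧ v = Pi.single i 1 + Pi.single j 1

theorem IsGraphic.finite [Finite ι] (hA : IsGraphic A) : A.Finite := by
  refine (((Set.finite_range fun p : ι × ι => Pi.single p.1 1 + Pi.single p.2 1).union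
    (Set.finite_range fun i => Pi.single i 1)).insert 0).subset fun v hv => ?_
  rcases hA.eq_zero_or_vertex_or_edge v hv with rfl | ⟨i, rfl⟩ | ⟨i, j, -, rfl⟩
  · exact .inl rfl
  · exact .inr (.inr ⟨i, rfl⟩)
  · exact .inr (.inl ⟨(i, j), rfl⟩)

theorem isGraphic_of_card_support_le_two [Finite ι] (hsingle : ∀ i, Pi.single i 1 ∈ A)
    (hbinary : ∀ v ∈ A, ∀ i, v i = 0 ∨ v i = 1) (hcard : ∀ v ∈ A, {i | v i ≠ 0}.ncard ≤ 2) :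
    IsGraphic A := by
  refine ⟨hsingle, fun v hv => ?_⟩
  have hv_eq : v = {i | v i ≠ 0}.indicator 1 := by
    ext i
    rcases hbinary v hv i with h | h <;> simp [h]
  have hcard_v := hcard v hv
  interval_cases hc : {i | v i ≠ 0}.ncard
  · left
    rw [hv_eq, (Set.ncard_eq_zero).1 hc, Set.indicator_empty]
    rfl
  · right; left
    obtain ⟨i, hi⟩ := Set.ncard_eq_one.1 hc
    refine ⟨i, ?_⟩
    rw [hv_eq, hi]
    ext k
    simp [Pi.single_apply, Set.indicator_apply]
  · right; right
    obtain ⟨i, j, hij, hpair⟩ := Set.ncard_eq_two.1 hc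
    refine ⟨i, j, hij, ?_⟩
    rw [hv_eq, hpair]
    ext k
    by_cases hki : k = i
    · simp [hki, hij]
    · simp [hki, Pi.single_apply, Set.indicator_apply]

variable [Fintype ι]

theorem half_mem_packings (hA : IsGraphic A) : (fun _ => 1 / 2) ∈ packings A := by
  refine ⟨fun _ => by norm_num, fun v hv => ?_⟩
  rcases hA.eq_zero_or_vertex_or_edge v hv with rfl | ⟨i, rfl⟩ | ⟨i, j, -, rfl⟩ <;>
    norm_num [dotProduct_add]

theorem card_div_two_le_packingNumber (hA : IsGraphic A) :
    (Fintype.card ι : ℝ) / 2 ≤ packingNumber A := by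
  simpa [div_eq_mul_inv] using
    sum_le_packingNumber (maxPackings_nonempty hA.single_mem) (half_mem_packings hA)

theorem packingNumber_eq_card_or_le (hA : IsGraphic A) :
    packingNumber A = Fintype.card ι ∨ packingNumber A ≤ Fintype.card ι - 1 := by
  obtain ⟨x, hx⟩ := maxPackings_nonempty hA.single_mem
  have hle := le_one_of_mem_packings hA.single_mem hx.1
  by_cases hedge : ∃ i j, i ≠ j ∧ Pi.single i 1 + Pi.single j 1 ∈ A
  · obtain ⟨i, j, hij, hmem⟩ := hedge
    have hxij : x i + x j ≤ 1 := by simpa [dotProduct_add] using hx.1.2 _ hmem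
    have hpair : (1 - x i) + (1 - x j) ≤ ∑ k, (1 - x k) := by
      rw [← Finset.sum_pair (f := fun k => 1 - x k) hij]
      exact Finset.sum_le_sum_of_subset_of_nonneg (Finset.subset_univ _)
        fun k _ _ => sub_nonneg.2 (hle k)
    right
    simp only [Finset.sum_sub_distrib, Finset.sum_const, Finset.card_univ, nsmul_eq_mul, mul_one,
      sum_eq_packingNumber hx] at hpair
    linarith
  · have hone : 1 ∈ packings A := by
      refine ⟨zero_le_one, fun v hv => ?_⟩
      rcases hA.eq_zero_or_vertex_or_edge v hv with rfl | ⟨i, rfl⟩ | ⟨i, j, hij, rfl⟩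
      · simp
      · simp
      · exact absurd ⟨i, j, hij, hv⟩ hedge
    left
    refine le_antisymm ?_ (by simpa using sum_le_packingNumber ⟨x, hx⟩ hone)
    rw [← sum_eq_packingNumber hx]
    simpa using Finset.sum_le_sum fun i (_ : i ∈ Finset.univ) => hle i

/-- Twice the distance from `1` of the point of `{0, 1 / 2, 1}` to which `r ∈ [0, 1]` is rounded:
everything below `1 / 2` is rounded to `0` and everything above `1 / 2` to `1`. -/
noncomputable def roundingDefect (r : ℝ) : ℕ :=
  if r < 1 / 2 then 2 else if r = 1 / 2 then 1 else 0

theorem roundingDefect_zero : roundingDefect 0 = 2 := by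
  norm_num [roundingDefect]

theorem roundingDefect_one : roundingDefect 1 = 0 := by
  norm_num [roundingDefect]

theorem roundingDefect_add_roundingDefect {a b : ℝ} (h : a + b = 1) :
    roundingDefect a + roundingDefect b = 2 := by
  grind [roundingDefect]

/-- Rounding preserves the tight constraints, and so does moving in the opposite direction; hence
it does not change the total weight. -/
theorem sum_roundingDefect (hA : IsGraphic A) (hx : x ∈ maxPackings A) :
    ∑ i, (roundingDefect (x i) : ℝ) = 2 * (Fintype.card ι - packingNumber A) := by
  have hsum : ∑ i, (2 * (1 - x i) - roundingDefect (x i)) = 0 := by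
    refine sum_eq_zero_of_active hA.finite hx (fun i hi => ?_) fun v hv hxv => ?_
    · norm_num [hi, roundingDefect_zero]
    · rcases hA.eq_zero_or_vertex_or_edge v hv with rfl | ⟨i, rfl⟩ | ⟨i, j, -, rfl⟩
      · simp
      · have hi : x i = 1 := by simpa using hxv
        simp [hi, roundingDefect_one]
      · have hij : x i + x j = 1 := by simpa [dotProduct_add] using hxv
        have hdefect : (roundingDefect (x i) : ℝ) + roundingDefect (x j) = 2 := by
          exact_mod_cast roundingDefect_add_roundingDefect hij
        simp only [dotProduct_add, dotProduct_single_one]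
        linarith
  simp only [Finset.sum_sub_distrib, ← Finset.mul_sum, sum_eq_packingNumber hx, Finset.sum_const,
    Finset.card_univ, nsmul_eq_mul, mul_one] at hsum
  linarith

/-- Twice the gap between the trivial bound `Fintype.card ι` and the fractional packing number. The
floor is harmless for graphic families, by half-integrality. -/
noncomputable def deficiency (A : Set (ι → ℝ)) : ℕ :=
  ⌊2 * (Fintype.card ι - packingNumber A)⌋₊

theorem deficiency_eq_sum_roundingDefect (hA : IsGraphic A) (hx : x ∈ maxPackings A) :
    deficiency A = ∑ i, roundingDefect (x i) := by
  rw [deficiency, ← sum_roundingDefect hA hx, ← Nat.cast_sum, Nat.floor_natCast]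

theorem cast_deficiency (hA : IsGraphic A) :
    (deficiency A : ℝ) = 2 * (Fintype.card ι - packingNumber A) := by
  obtain ⟨x, hx⟩ := maxPackings_nonempty hA.single_mem
  rw [deficiency_eq_sum_roundingDefect hA hx, Nat.cast_sum, sum_roundingDefect hA hx]

theorem deficiency_le_card (hA : IsGraphic A) : deficiency A ≤ Fintype.card ι := by
  have hle : (deficiency A : ℝ) ≤ Fintype.card ι := by
    linarith [cast_deficiency hA, card_div_two_le_packingNumber hA]
  exact_mod_cast hle

theorem deficiency_ne_one (hA : IsGraphic A) : deficiency A ≠ 1 := by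
  intro h
  have hcast := cast_deficiency hA
  rw [h, Nat.cast_one] at hcast
  rcases packingNumber_eq_card_or_le hA with hν | hν <;> linarith

theorem eq_zero_of_mem_vectorSpan_maxPackings (hA : IsGraphic A) (hx : x ∈ maxPackings A)
    (htight : ∀ v ∈ A, x ⬝ᵥ v = 1 → ∀ z ∈ maxPackings A, z ⬝ᵥ v = 1)
    (hhalf : ∀ i, x i = 1 / 2 → ∀ z ∈ maxPackings A, z i = 1 / 2) {d : ι → ℝ}
    (hd : d ∈ vectorSpan ℝ (maxPackings A)) (hlow : ∀ i, x i < 1 / 2 → d i = 0) : d = 0 := by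
  have hd_tight : ∀ v ∈ A, x ⬝ᵥ v = 1 → d ⬝ᵥ v = 0 := fun v hv hxv =>
    map_eq_zero_of_mem_vectorSpan (f := (dotProductBilin ℝ ℝ).flip v) (htight v hv hxv) hd
  have hd_edge : ∀ i j, 1 / 2 < x i → x i + x j = 1 → d i + d j = 0 → d i = 0 :=
    fun i j hi hij h => by simpa [hlow j (by linarith)] using h
  ext i
  rcases lt_trichotomy (x i) (1 / 2) with hi | hi | hi
  · exact hlow i hi
  · exact map_eq_zero_of_mem_vectorSpan (f := LinearMap.proj i) (hhalf i hi) hd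
  · obtain ⟨v, hv, hvi, hxv⟩ := exists_tight_pos hA.finite hx i
    have hdv := hd_tight v hv hxv
    rcases hA.eq_zero_or_vertex_or_edge v hv with rfl | ⟨j, rfl⟩ | ⟨j, k, -, rfl⟩
    · simp at hvi
    · obtain rfl : i = j := by
        by_contra hij
        simp [hij] at hvi
      simpa using hdv
    · simp only [dotProduct_add, dotProduct_single_one] at hxv hdv
      by_cases hij : i = j
      · subst hij
        exact hd_edge i k hi hxv hdv
      · obtain rfl : i = k := by
          by_contra hik
          simp [hij, hik] at hvi
        exact hd_edge i j hi (by rwa [add_comm]) (by rwa [add_comm])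

theorem exists_maxPacking_faceDim_le (hA : IsGraphic A) :
    ∃ x ∈ maxPackings A, faceDim A ≤ #{i | x i < 1 / 2} := by
  obtain ⟨x, hx, htight, hhalf⟩ :=
    exists_generic_maxPacking hA.finite (maxPackings_nonempty hA.single_mem)
  refine ⟨x, hx, ?_⟩
  let restrict : vectorSpan ℝ (maxPackings A) →ₗ[ℝ] ({i // x i < 1 / 2} → ℝ) :=
    LinearMap.funLeft ℝ ℝ Subtype.val ∘ₗ (vectorSpan ℝ (maxPackings A)).subtype
  have hinj : Function.Injective restrict := by
    rw [injective_iff_map_eq_zero]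
    rintro ⟨d, hd⟩ hd0
    exact Subtype.ext <| eq_zero_of_mem_vectorSpan_maxPackings hA hx htight hhalf hd
      fun i hi => congrFun hd0 ⟨i, hi⟩
  simpa [faceDim, Fintype.card_subtype] using LinearMap.finrank_le_finrank_of_injective hinj

theorem two_mul_faceDim_le_deficiency (hA : IsGraphic A) : 2 * faceDim A ≤ deficiency A := by
  obtain ⟨x, hx, hdim⟩ := exists_maxPacking_faceDim_le hA
  calc 2 * faceDim A ≤ 2 * #{i | x i < 1 / 2} := by gcongr
    _ = ∑ i, if x i < 1 / 2 then 2 else 0 := by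
      rw [Finset.card_filter, Finset.mul_sum]
      simp only [mul_ite, mul_one, mul_zero]
    _ ≤ ∑ i, roundingDefect (x i) := Finset.sum_le_sum fun i _ => by
      rw [roundingDefect]
      split_ifs <;> simp
    _ = deficiency A := (deficiency_eq_sum_roundingDefect hA hx).symm

theorem deficiency_mono {A B : Set (ι → ℝ)} (hA : ∀ i, Pi.single i 1 ∈ A) (h : A ⊆ B) :
    deficiency A ≤ deficiency B := by
  have hν := packingNumber_anti (maxPackings_nonempty hA)
    (maxPackings_nonempty fun i => h (hA i)) h
  unfold deficiency
  gcongr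

end Graphic

section Profile

/-- The pairs `(j, d)` that can occur as deficiency and face dimension of a graphic family on at
most `N` points. -/
def profiles (N : ℕ) : Finset (ℕ × ℕ) :=
  ((Finset.range (N + 1)).erase 1).biUnion fun j => {j} ×ˢ Finset.range (j / 2 + 1)

theorem mem_profiles {N : ℕ} {p : ℕ × ℕ} :
    p ∈ profiles N ↔ p.1 ≤ N ∧ p.1 ≠ 1 ∧ 2 * p.2 ≤ p.1 := by
  simp only [profiles, Finset.mem_biUnion, Finset.mem_erase, Finset.mem_range, Finset.mem_product,
    Finset.mem_singleton]
  grind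

theorem card_profiles_succ {N : ℕ} (hN : 1 ≤ N) :
    #(profiles (N + 1)) = #(profiles N) + ((N + 1) / 2 + 1) := by
  have hinsert : (Finset.range (N + 1 + 1)).erase 1 =
      insert (N + 1) ((Finset.range (N + 1)).erase 1) := by
    rw [Finset.range_add_one, Finset.erase_insert_of_ne (by omega)]
  have hdisj : Disjoint ({N + 1} ×ˢ Finset.range ((N + 1) / 2 + 1)) (profiles N) := by
    rw [Finset.disjoint_left]
    rintro ⟨j, d⟩ hp hp'
    rw [Finset.mem_product, Finset.mem_singleton] at hp
    have := (mem_profiles.1 hp').1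
    omega
  rw [profiles, hinsert, Finset.biUnion_insert, ← profiles, Finset.card_union_of_disjoint hdisj,
    Finset.card_product, Finset.card_singleton, Finset.card_range, one_mul, add_comm]

theorem four_mul_card_profiles {N : ℕ} (hN : 1 ≤ N) :
    4 * #(profiles N) + N % 2 = N * (N + 4) := by
  induction N, hN using Nat.le_induction with
  | base => rfl
  | succ N hN ih =>
    rw [card_profiles_succ hN]
    have : (N + 1) * (N + 1 + 4) = N * (N + 4) + (2 * N + 5) := by ring
    omega

end Profile

end FractionalPacking

namespace DFAutomaton

open Matrix FractionalPacking
open scoped Finset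

variable {n t : ℕ} {S : DFAutomaton n} {L : Matrix (Fin n) (Fin n) ℝ}
  {w : List (Matrix (Fin n) (Fin n) ℝ)} {x v : Fin n → ℝ}

theorem prod_apply_eq_zero_or_one (hw : ∀ L ∈ w, L ∈ S.letters) (i j : Fin n) :
    w.prod i j = 0 ∨ w.prod i j = 1 := by
  have hstoch : w.prod ∈ rowStochastic ℝ (Fin n) :=
    Submonoid.list_prod_mem _ fun L hL => S.stochastic L (hw L hL)
  have hnat : w.prod ∈ (Nat.castRingHom ℝ).rangeS.matrix :=
    Subsemiring.list_prod_mem _ fun L hL i j => by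
      rcases S.binary L (hw L hL) i j with h | h
      exacts [⟨0, by simp [h]⟩, ⟨1, by simp [h]⟩]
  obtain ⟨m, hm⟩ := hnat i j
  have hle : (m : ℝ) ≤ 1 := hm.trans_le (le_one_of_mem_rowStochastic hstoch)
  rw [← hm]
  have : m ≤ 1 := by exact_mod_cast hle
  interval_cases m <;> simp

theorem reachable_eq_zero_or_one (hv : v ∈ S.reachable t) (i : Fin n) : v i = 0 ∨ v i = 1 := by
  obtain ⟨W, ⟨s, -, w, hw, -, rfl⟩, j, rfl⟩ := hv
  exact prod_apply_eq_zero_or_one hw i j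

theorem finite_reachable (S : DFAutomaton n) (t : ℕ) : (S.reachable t).Finite :=
  (Set.Finite.pi' fun _ => Set.toFinite {0, 1}).subset fun _ hv => reachable_eq_zero_or_one hv

theorem single_mem_reachable (S : DFAutomaton n) (t : ℕ) (i : Fin n) :
    Pi.single i 1 ∈ S.reachable t := by
  refine ⟨1, ⟨0, t.zero_le, [], by simp, rfl, rfl⟩, i, ?_⟩
  ext j
  simp [Matrix.one_apply, Pi.single_apply]

theorem reachable_mono (S : DFAutomaton n) : Monotone S.reachable := by
  rintro s t hst v ⟨W, ⟨r, hr, hW⟩, j, rfl⟩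
  exact ⟨W, ⟨r, hr.trans hst, hW⟩, j, rfl⟩

theorem mulVec_mem_reachable (hL : L ∈ S.letters) (hv : v ∈ S.reachable t) :
    L *ᵥ v ∈ S.reachable (t + 1) := by
  obtain ⟨W, ⟨s, hs, w, hw, rfl, rfl⟩, j, rfl⟩ := hv
  exact ⟨L * w.prod, ⟨w.length + 1, by omega, L :: w, List.forall_mem_cons.2 ⟨hL, hw⟩, rfl,
    List.prod_cons⟩, j, rfl⟩

theorem maxPackings_reachable_nonempty (S : DFAutomaton n) (t : ℕ) :
    (maxPackings (S.reachable t)).Nonempty :=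
  maxPackings_nonempty (S.single_mem_reachable t)

theorem vecMul_mem_packings (hL : L ∈ S.letters) (hx : x ∈ packings (S.reachable (t + 1))) :
    x ᵥ* L ∈ packings (S.reachable t) := by
  refine ⟨nonneg_vecMul_of_mem_rowStochastic (S.stochastic L hL) hx.1, fun v hv => ?_⟩
  rw [← dotProduct_mulVec]
  exact hx.2 _ (mulVec_mem_reachable hL hv)

theorem maxPackings_succ_subset
    (hν : packingNumber (S.reachable (t + 1)) = packingNumber (S.reachable t)) :
    maxPackings (S.reachable (t + 1)) ⊆ maxPackings (S.reachable t) := fun _ hx =>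
  mem_maxPackings_of_sum_eq (S.maxPackings_reachable_nonempty t)
    (packings_anti (S.reachable_mono t.le_succ) hx.1) ((sum_eq_packingNumber hx).trans hν)

theorem vecMul_mem_maxPackings
    (hν : packingNumber (S.reachable (t + 1)) = packingNumber (S.reachable t))
    (hL : L ∈ S.letters) (hx : x ∈ maxPackings (S.reachable (t + 1))) :
    x ᵥ* L ∈ maxPackings (S.reachable t) :=
  mem_maxPackings_of_sum_eq (S.maxPackings_reachable_nonempty t) (vecMul_mem_packings hL hx.1)
    ((sum_vecMul_of_mem_rowStochastic (S.stochastic L hL)).trans <|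
      (sum_eq_packingNumber hx).trans hν)

/-- A synchronizing word sends an optimal `x` to a multiple of a basis vector while moving it only
within the optimal face's span, on which some constraint is constant. -/
theorem packingNumber_eq_one_of_vectorSpan_eq (hS : S.IsSynchronizing)
    (hν : packingNumber (S.reachable (t + 1)) = packingNumber (S.reachable t))
    (hspan : vectorSpan ℝ (maxPackings (S.reachable (t + 1))) =
      vectorSpan ℝ (maxPackings (S.reachable t))) :
    packingNumber (S.reachable t) = 1 := by
  obtain ⟨i, -, w, hw, -, hsync⟩ := hS
  have : Nonempty (Fin n) := ⟨i⟩
  obtain ⟨x, hx⟩ := S.maxPackings_reachable_nonempty (t + 1)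
  have hx' := maxPackings_succ_subset hν hx
  have hmem : x ᵥ* w.prod - x ∈ vectorSpan ℝ (maxPackings (S.reachable t)) := by
    refine vecMul_prod_sub_mem (fun L hL d hd => ?_) fun L hL => ?_
    · exact map_mem_vectorSpan (f := L.vecMulLinear)
        (fun y hy => vecMul_mem_maxPackings hν (hw L hL) hy) (hspan ▸ hd)
    · exact vsub_mem_vectorSpan ℝ (vecMul_mem_maxPackings hν (hw L hL) hx) hx'
  obtain ⟨v, hv, htight⟩ := exists_mem_forall_maxPackings_tight (S.finite_reachable t)
    (S.maxPackings_reachable_nonempty t)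
  have hconst : (x ᵥ* w.prod - x) ⬝ᵥ v = 0 :=
    map_eq_zero_of_mem_vectorSpan (f := (dotProductBilin ℝ ℝ).flip v) htight hmem
  have hprod : packingNumber (S.reachable t) * v i = 1 := by
    rwa [sub_dotProduct, htight x hx', hsync, vecMul_vecMulVec, dotProduct_one, smul_dotProduct,
      single_one_dotProduct, smul_eq_mul, sum_eq_packingNumber hx', sub_eq_zero] at hconst
  rcases reachable_eq_zero_or_one hv i with h | h
  · simp [h] at hprod
  · simpa [h] using hprod

theorem faceDim_reachable_succ_lt (hS : S.IsSynchronizing)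
    (hν : packingNumber (S.reachable (t + 1)) = packingNumber (S.reachable t))
    (hne : packingNumber (S.reachable t) ≠ 1) :
    faceDim (S.reachable (t + 1)) < faceDim (S.reachable t) :=
  Submodule.finrank_lt_finrank_of_lt <|
    (vectorSpan_mono ℝ (maxPackings_succ_subset hν)).lt_of_ne fun hspan =>
      hne (packingNumber_eq_one_of_vectorSpan_eq hS hν hspan)

theorem isGraphic_reachable (ht : t < S.tripleRendezvousTime) : IsGraphic (S.reachable t) :=
  isGraphic_of_card_support_le_two (S.single_mem_reachable t)
    (fun _ hv => reachable_eq_zero_or_one hv) fun v hv =>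
      Nat.le_of_lt_succ <| not_le.1 fun h => Nat.notMem_of_lt_sInf ht ⟨v, hv, h⟩

theorem profile_reachable_mem_profiles (ht : t < S.tripleRendezvousTime) :
    (deficiency (S.reachable t), faceDim (S.reachable t)) ∈ profiles n := by
  have hG := isGraphic_reachable ht
  refine mem_profiles.2 ⟨?_, deficiency_ne_one hG, two_mul_faceDim_le_deficiency hG⟩
  simpa using deficiency_le_card hG

theorem faceDim_lt_of_deficiency_eq (hn : 3 ≤ n) (hS : S.IsSynchronizing)
    (ht : t + 1 < S.tripleRendezvousTime)
    (h : deficiency (S.reachable t) = deficiency (S.reachable (t + 1))) :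
    faceDim (S.reachable (t + 1)) < faceDim (S.reachable t) := by
  have hG := isGraphic_reachable (t.lt_succ_self.trans ht)
  have hG' := isGraphic_reachable ht
  have hν : packingNumber (S.reachable (t + 1)) = packingNumber (S.reachable t) := by
    have hcast := cast_deficiency hG
    rw [h, cast_deficiency hG'] at hcast
    linarith
  refine faceDim_reachable_succ_lt hS hν (ne_of_gt ?_)
  have hhalf := card_div_two_le_packingNumber hG
  have hn' : (3 : ℝ) ≤ n := by exact_mod_cast hn
  rw [Fintype.card_fin] at hhalf
  linarith

theorem injOn_profile_reachable (hn : 3 ≤ n) (hS : S.IsSynchronizing) :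
    Set.InjOn (fun t => (deficiency (S.reachable t), faceDim (S.reachable t)))
      (Set.Iio S.tripleRendezvousTime) := by
  have hmono : StrictMonoOn (fun t =>
      toLex (deficiency (S.reachable t), OrderDual.toDual (faceDim (S.reachable t))))
      (Set.Iio S.tripleRendezvousTime) :=
    strictMonoOn_of_lt_succ Set.ordConnected_Iio fun t _ _ ht => Prod.Lex.toLex_lt_toLex'.2
      ⟨deficiency_mono (S.single_mem_reachable t) (S.reachable_mono t.le_succ),
        faceDim_lt_of_deficiency_eq hn hS ht⟩
  exact fun s hs t ht h => hmono.injOn hs ht (by simpa using h)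

theorem tripleRendezvousTime_le_card_profiles (hn : 3 ≤ n) (hS : S.IsSynchronizing) :
    S.tripleRendezvousTime ≤ #(profiles n) := by
  rw [← Finset.card_range S.tripleRendezvousTime]
  refine Finset.card_le_card_of_injOn _
    (fun t ht => profile_reachable_mem_profiles (Finset.mem_range.1 ht)) ?_
  rw [Finset.coe_range]
  exact injOn_profile_reachable hn hS

theorem tripleTimes_nonempty (hn : 3 ≤ n) (hS : S.IsSynchronizing) : S.tripleTimes.Nonempty := by
  obtain ⟨i, t, hW⟩ := hS
  refine ⟨t, _, ⟨_, ⟨t, le_rfl, hW⟩, i, rfl⟩, ?_⟩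
  simpa [weight, vecMulVec_apply, Set.ncard_univ] using hn

end DFAutomaton

theorem mainTheorem3 (n : ℕ) (hn : 3 ≤ n) (S : DFAutomaton n) (hS : S.IsSynchronizing) :
    S.tripleTimes.Nonempty ∧
      (S.tripleRendezvousTime : ℝ) ≤ (n : ℝ) * (n + 4) / 4 - ((n % 2 : ℕ) : ℝ) / 4 := by
  refine ⟨DFAutomaton.tripleTimes_nonempty hn hS, ?_⟩
  have hle := DFAutomaton.tripleRendezvousTime_le_card_profiles hn hS
  have hcard := FractionalPacking.four_mul_card_profiles (show 1 ≤ n by omega)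
  have hbound : 4 * S.tripleRendezvousTime + n % 2 ≤ n * (n + 4) := by omega
  have hbound' : 4 * (S.tripleRendezvousTime : ℝ) + (n % 2 : ℕ) ≤ n * (n + 4) := by
    exact_mod_cast hbound
  linarith
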